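/- **Setting.** Let $\alpha_2,p,q,a,c_1,c_2\in\mathbb C$ with $p\ne a$, $q\ne a$. Put $g_3(k)=k^3+\alpha_2k^2$, $G_3(u,v)=g_3(u)-g_3(v)$, $c_3=\alpha_2/3$ and $$P=-G_3(-p,-a),\quad Q=-G_3(-q,-a),\quad p_a=\frac{P}{p-a},\quad q_a=\frac{Q}{q-a}.$$ For a function $u$ of $(n,m,\alpha)\in\mathbb Z^3$ write $\tilde u,\hat u$ for the shifts $n\mapsto n+1$, $m\mapsto m+1$, and $\mathring u$ for the backward shift $\alpha\mapsto\alpha-1$. The A2 equations for $x,y,z$ on $\mathbb Z^2$ are (where $\tilde z\neq\hat z$) $$A_1:=\tilde xz-\tilde y-x=0,\quad A_2:=\hat xz-\hat y-x=0,\quad A_3:=x\hat{\tilde z}-y-\frac{P\tilde x-Q\hat x}{\tilde z-\hat z}=0.$$ Let $x_a=(p-a)^{-n}(q-a)^{-m}c_1$, $z_0=(c_3-p)n+(c_3-q)m+c_2$, $y_a=x_a(z_0+a-c_3)$. For $f,g:\mathbb Z^3\to\mathbb C$ and fixed $\alpha$ put $$x=x_a\frac{\mathring f}{f},\qquad z=z_0+\frac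 gf,\qquad y=y_a\frac{\mathring f}{f}+x_a\frac{\mathring g}{f},\tag{T}$$ $$\begin{aligned}\mathcal A_1&=\tilde{\mathring f}(g+pf)-(p-a)\mathring f\tilde f-f(a\tilde{\mathring f}+\tilde{\mathring g}),\\ \mathcal A_2&=\hat{\mathring f}(g+qf)-(q-a)\mathring f\hat f-f(a\hat{\mathring f}+\hat{\mathring g}),\\ \mathcal A_3&=\tilde f\hat g-\hat f\tilde g+(p-q)(\tilde f\hat f-f\hat{\tilde f}),\\ \mathcal A_4&=(p-q)\big[((p+q+a-\alpha_2)\mathring f+\mathring g)\hat{\tilde f}-\hat{\tilde g}\mathring f\big]-p_a\hat f\tilde{\mathring f}+q_a\tilde f\hat{\mathring f}.\end{aligned}$$ **(1) Relation.** Under (T), at every lattice point where the denominators do not vanish, $$A_1=\frac{\tilde x_a\mathcal A_1}{f\tilde f},\quad A_2=\frac{\hat x_a\mathcal A_2}{f\hat f},\quad A_3=x_a\frac{\mathcal A_3\mathcal A_4+(p-q)f\hat{\tilde f}\mathcal A_4+(p_a\hat f\tilde{\mathring f}-q_a\tilde f\hat{\mathring f})\mathcal A_3}{(p-q)f\tilde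 f\hat f\hat{\tilde f}(\tilde z-\hat z)}.$$ **(2) Bilinearization.** Let $p\ne q$ and let $f$ be nonzero at the four corners $f,\tilde f,\hat f,\hat{\tilde f}$ of an elementary square. If $\mathcal A_1=\mathcal A_2=\mathcal A_3=\mathcal A_4=0$ there, then $\tilde z\ne\hat z$ and $A_1=A_2=A_3=0$. Conversely, if $c_1\neq0$ and $\mathcal A_3=0$, the A2 equations imply $\mathcal A_1=\mathcal A_2=\mathcal A_4=0$. The bilinear system $\mathcal A_1=\dots=\mathcal A_4=0$ is invariant under $g\mapsto g+cf$ for every constant $c$. **(3) Casoratian solutions.** Let $N\ge1$, $k_1,\dots,k_N\in\mathbb C$, $\omega_0(k_j)=k_j$, and let $\omega_1(k_j),\omega_2(k_j)$ be roots of $g_3(-\omega)=g_3(-k_j)$; assume that no $\omega_s(k_j)$ equals $p$, $q$ or $a$. Let $b,\delta,\varrho_{j,s}\in\mathbb C$, $\beta\in\mathbb Z$ and $$\psi_j(l)=\sum_{s=0}^2(\delta-\omega_s(k_j))^l(p-\omega_s(k_j))^n(q-\omega_s(k_j))^m(a-\omega_s(k_j))^\alpha(b-\omega_s(k_j))^\beta\varrho_{j,s},\qquad\psi=(\psi_1,\dots,\psi_N)^T.$$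 With $\delta=0$, the Casoratians $f=|\widehat{N-1}|=|\psi(0),\psi(1),\dots,\psi(N-1)|$ and $g=|\widehat{N-2},N|=|\psi(0),\dots,\psi(N-2),\psi(N)|$ satisfy $\mathcal A_1=\mathcal A_2=\mathcal A_3=\mathcal A_4=0$ for all $(n,m,\alpha)$. Consequently, if $p\ne q$, the functions $x,y,z$ of (T) satisfy the A2 equations, with $\tilde z\ne\hat z$, on every elementary square at whose corners $f$ does not vanish. **(4) $\delta$-deformation.** The A2-$\delta$ equations are (where $\tilde z'\neq\hat z'$) $$\tilde x'z'-\tilde y'-x'-\delta\tilde x'=0,\quad\hat x'z'-\hat y'-x'-\delta\hat x'=0,\quad x'\hat{\tilde z}'-y'-\delta x'-\frac{P\tilde x'-Q\hat x'}{\tilde z'-\hat z'}=0.$$ For arbitrary functions, $(x,y,z)$ satisfies A2 on an elementary square if and only if $(x',y',z')=(x,y,z+\delta)$ satisfies A2-$\delta$ there. Let $f,g$ be the Casoratians of (3) for $\delta=0$ and $f',g'$ the same Casoratians for arbitrary $\delta$. Then $f'=f$, $g'=g+N\delta f$, and $f',g'$ also satisfy $\mathcal A_1=\dots=\mathcal A_4=0$.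 Let $z_0',y_a'$ be $z_0,y_a$ with $c_2$ replaced by $c_2'$, where $c_2'-c_2+N\delta=0$, and put $$x'=x_a\frac{\mathring f'}{f'},\qquad z'=\delta+z_0'+\frac{g'}{f'},\qquad y'=y_a'\frac{\mathring f'}{f'}+x_a\frac{\mathring g'}{f'}.$$ Then, wherever $f\neq0$, $x=x'$, $y=y'$, $z=z'-\delta$ with $x,y,z$ from (T); and if $p\ne q$, then $x',y',z'$ satisfy the A2-$\delta$ equations, with $\tilde z'\neq\hat z'$, on every elementary square at whose corners $f'$ does not vanish. -/

import Mathlib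

namespace BilinearA2

/-- The cubic `g₃(k) = k³ + α₂ k²`. -/
def g3 (α₂ k : ℂ) : ℂ := k ^ 3 + α₂ * k ^ 2

/-- `G₃(u, v) = g₃(u) - g₃(v)`. -/
def G3 (α₂ u v : ℂ) : ℂ := g3 α₂ u - g3 α₂ v

/-- The lattice parameter `P = -G₃(-p, -a)`; the parameter `Q` is `latticeP α₂ a q`. -/
def latticeP (α₂ a p : ℂ) : ℂ := -G3 α₂ (-p) (-a)

/-- `p_a = -G₃(-p, -a) / (p - a)`; likewise `q_a = subA α₂ a q`. -/
noncomputable def subA (α₂ a p : ℂ) : ℂ := latticeP α₂ a p / (p - a)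

/-! ### The A2 equations and their `δ`-deformation, for `x y z : ℤ → ℤ → ℂ` at the site `(n, m)` -/

/-- Left-hand side of `x̃ z - ỹ - x = 0`. -/
def A2eq1 (x y z : ℤ → ℤ → ℂ) (n m : ℤ) : ℂ :=
  x (n + 1) m * z n m - y (n + 1) m - x n m

/-- Left-hand side of `x̂ z - ŷ - x = 0`. -/
def A2eq2 (x y z : ℤ → ℤ → ℂ) (n m : ℤ) : ℂ :=
  x n (m + 1) * z n m - y n (m + 1) - x n m

/-- Left-hand side of the third A2 equation, which presupposes `z̃ ≠ ẑ`. -/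
noncomputable def A2eq3 (P Q : ℂ) (x y z : ℤ → ℤ → ℂ) (n m : ℤ) : ℂ :=
  x n m * z (n + 1) (m + 1) - y n m
    - (P * x (n + 1) m - Q * x n (m + 1)) / (z (n + 1) m - z n (m + 1))

/-- `x, y, z` satisfy the A2 equations on the elementary square based at `(n, m)`; this includes
that the denominator of the third equation does not vanish. -/
def SolvesA2At (P Q : ℂ) (x y z : ℤ → ℤ → ℂ) (n m : ℤ) : Prop :=
  z (n + 1) m ≠ z n (m + 1) ∧ A2eq1 x y z n m = 0 ∧ A2eq2 x y z n m = 0 ∧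
    A2eq3 P Q x y z n m = 0

def A2deltaEq1 (δ : ℂ) (x y z : ℤ → ℤ → ℂ) (n m : ℤ) : ℂ :=
  x (n + 1) m * z n m - y (n + 1) m - x n m - δ * x (n + 1) m

def A2deltaEq2 (δ : ℂ) (x y z : ℤ → ℤ → ℂ) (n m : ℤ) : ℂ :=
  x n (m + 1) * z n m - y n (m + 1) - x n m - δ * x n (m + 1)

noncomputable def A2deltaEq3 (δ P Q : ℂ) (x y z : ℤ → ℤ → ℂ) (n m : ℤ) : ℂ :=
  x n m * z (n + 1) (m + 1) - y n m - δ * x n m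
    - (P * x (n + 1) m - Q * x n (m + 1)) / (z (n + 1) m - z n (m + 1))

def SolvesA2deltaAt (δ P Q : ℂ) (x y z : ℤ → ℤ → ℂ) (n m : ℤ) : Prop :=
  z (n + 1) m ≠ z n (m + 1) ∧ A2deltaEq1 δ x y z n m = 0 ∧ A2deltaEq2 δ x y z n m = 0 ∧
    A2deltaEq3 δ P Q x y z n m = 0

/-! ### Background solution -/

noncomputable def xSeed (p q a c₁ : ℂ) (n m : ℤ) : ℂ := (p - a) ^ (-n) * (q - a) ^ (-m) * c₁

/-- `z₀ = (c₃ - p) n + (c₃ - q) m + c₂` with `c₃ = α₂ / 3`. -/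
noncomputable def zSeed (α₂ p q c₂ : ℂ) (n m : ℤ) : ℂ :=
  (α₂ / 3 - p) * n + (α₂ / 3 - q) * m + c₂

noncomputable def ySeed (α₂ p q a c₁ c₂ : ℂ) (n m : ℤ) : ℂ :=
  xSeed p q a c₁ n m * (zSeed α₂ p q c₂ n m + a - α₂ / 3)

/-! ### Dependent variable transformation

Here `f` and `g` are functions of `(n, m, α)`, and the circle under a variable is the backward
shift `α ↦ α - 1`. -/

/-- `x = x_a f° / f`. -/
noncomputable def xOf (p q a c₁ : ℂ) (f : ℤ → ℤ → ℤ → ℂ) (α : ℤ) : ℤ → ℤ → ℂ := fun n m =>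
  xSeed p q a c₁ n m * (f n m (α - 1) / f n m α)

/-- `y = y_a f° / f + x_a g° / f`. -/
noncomputable def yOf (α₂ p q a c₁ c₂ : ℂ) (f g : ℤ → ℤ → ℤ → ℂ) (α : ℤ) : ℤ → ℤ → ℂ :=
  fun n m => ySeed α₂ p q a c₁ c₂ n m * (f n m (α - 1) / f n m α)
    + xSeed p q a c₁ n m * (g n m (α - 1) / f n m α)

/-- `z = z₀ + g / f`. -/
noncomputable def zOf (α₂ p q c₂ : ℂ) (f g : ℤ → ℤ → ℤ → ℂ) (α : ℤ) : ℤ → ℤ → ℂ :=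
  fun n m => zSeed α₂ p q c₂ n m + g n m α / f n m α

/-- `z' = δ + z₀ + g / f`: the transformation for the `δ`-deformed equations, whose background
solution is `(x_a, z₀ + δ, y_a)`. -/
noncomputable def zDeltaOf (δ α₂ p q c₂ : ℂ) (f g : ℤ → ℤ → ℤ → ℂ) (α : ℤ) : ℤ → ℤ → ℂ :=
  fun n m => δ + zSeed α₂ p q c₂ n m + g n m α / f n m α

/-! ### Left-hand sides of the bilinear equations -/

def bil1 (p a : ℂ) (f g : ℤ → ℤ → ℤ → ℂ) (n m α : ℤ) : ℂ :=
  f (n + 1) m (α - 1) * (g n m α + p * f n m α)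
    - (p - a) * f n m (α - 1) * f (n + 1) m α
    - f n m α * (a * f (n + 1) m (α - 1) + g (n + 1) m (α - 1))

def bil2 (q a : ℂ) (f g : ℤ → ℤ → ℤ → ℂ) (n m α : ℤ) : ℂ :=
  f n (m + 1) (α - 1) * (g n m α + q * f n m α)
    - (q - a) * f n m (α - 1) * f n (m + 1) α
    - f n m α * (a * f n (m + 1) (α - 1) + g n (m + 1) (α - 1))

def bil3 (p q : ℂ) (f g : ℤ → ℤ → ℤ → ℂ) (n m α : ℤ) : ℂ :=
  f (n + 1) m α * g n (m + 1) α - f n (m + 1) α * g (n + 1) m α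
    + (p - q) * (f (n + 1) m α * f n (m + 1) α - f n m α * f (n + 1) (m + 1) α)

noncomputable def bil4 (α₂ p q a : ℂ) (f g : ℤ → ℤ → ℤ → ℂ) (n m α : ℤ) : ℂ :=
  (p - q) * (((p + q + a - α₂) * f n m (α - 1) + g n m (α - 1)) * f (n + 1) (m + 1) α
      - g (n + 1) (m + 1) α * f n m (α - 1))
    - subA α₂ a p * f n (m + 1) α * f (n + 1) m (α - 1)
    + subA α₂ a q * f (n + 1) m α * f n (m + 1) (α - 1)

def SolvesBilinearAt (α₂ p q a : ℂ) (f g : ℤ → ℤ → ℤ → ℂ) (n m α : ℤ) : Prop :=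
  bil1 p a f g n m α = 0 ∧ bil2 q a f g n m α = 0 ∧ bil3 p q f g n m α = 0 ∧
    bil4 α₂ p q a f g n m α = 0

/-- `f` does not vanish at the four corners of the square based at `(n, m)`. -/
def NonzeroOnSquare (f : ℤ → ℤ → ℤ → ℂ) (n m α : ℤ) : Prop :=
  f n m α ≠ 0 ∧ f (n + 1) m α ≠ 0 ∧ f n (m + 1) α ≠ 0 ∧ f (n + 1) (m + 1) α ≠ 0

/-! ### Casoratians -/

/-- The Casoratian `|l₁, …, l_N|`: its columns are `ψ(l₁), …, ψ(l_N)`. -/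
def casoratian {N : ℕ} (ψ : Fin N → ℤ → ℂ) (l : Fin N → ℤ) : ℂ :=
  Matrix.det (Matrix.of fun j i : Fin N => ψ j (l i))

/-- Columns `0, 1, …, N - 1`. -/
def colsF (N : ℕ) (i : Fin N) : ℤ := (i : ℕ)

/-- Columns `0, 1, …, N - 2, N`. -/
def colsG (N : ℕ) (i : Fin N) : ℤ := if (i : ℕ) + 1 = N then (N : ℤ) else ((i : ℕ) : ℤ)

/-- The entry function
`ψ_j(l) = ∑ₛ (δ - ωₛ)^l (p - ωₛ)^n (q - ωₛ)^m (a - ωₛ)^α (b - ωₛ)^β ϱ_{j,s}`, `ωₛ = ωₛ(k_j)`. -/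
noncomputable def entry {N : ℕ} (δ p q a b : ℂ) (ω ϱ : Fin N → Fin 3 → ℂ) (n m α β : ℤ)
    (j : Fin N) (l : ℤ) : ℂ :=
  ∑ s : Fin 3, (δ - ω j s) ^ l * (p - ω j s) ^ n * (q - ω j s) ^ m * (a - ω j s) ^ α
    * (b - ω j s) ^ β * ϱ j s

/-- `f = |0, 1, …, N - 1|` as a function of `(n, m, α)`. -/
noncomputable def casF {N : ℕ} (δ p q a b : ℂ) (ω ϱ : Fin N → Fin 3 → ℂ) (β : ℤ) :
    ℤ → ℤ → ℤ → ℂ :=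
  fun n m α => casoratian (entry δ p q a b ω ϱ n m α β) (colsF N)

/-- `g = |0, 1, …, N - 2, N|` as a function of `(n, m, α)`. -/
noncomputable def casG {N : ℕ} (δ p q a b : ℂ) (ω ϱ : Fin N → Fin 3 → ℂ) (β : ℤ) :
    ℤ → ℤ → ℤ → ℂ :=
  fun n m α => casoratian (entry δ p q a b ω ϱ n m α β) (colsG N)

/-- For every `j`, `ω₀(k_j) = k_j`, and `ω₁(k_j)`, `ω₂(k_j)` are roots of `g₃(-ω) = g₃(-k_j)`. -/
def IsDispersion {N : ℕ} (α₂ : ℂ) (k : Fin N → ℂ) (ω : Fin N → Fin 3 → ℂ) : Prop :=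
  ∀ j, ω j 0 = k j ∧ ∀ s, g3 α₂ (-ω j s) = g3 α₂ (-k j)

end BilinearA2

open BilinearA2

/-! ### Casoratians of a linear map on polynomials. -/

namespace BilinearA2

open Polynomial Filter Topology

/-! The Casoratian entries are values of a linear map `L : ℂ[X] → ℂ^N`: the monomial `X ^ l`
produces column `l`, and the shifts in `n`, `m`, `α` amount to multiplying the argument of `L` by `X
+ p`, `X + q`, `X + a`. So `f` and `g` are `tau L r` and `sigma L r` for products `r` of such
factors, and the bilinear equations become identities between these determinants.

If `tau L 1 ≠ 0`, then `L` kills a monic `π` of degree `N`. Its value at `-s` gives `tau L (X + C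
s)` (`tau_X_add_C`), and its subleading coefficient gives `sigma L 1` (`sigma_one`). Comparing the
annihilators of `L` and of two of its shifts proves `three_term`, which yields the first three
bilinear equations. Combining instances of it gives `four_parameter`. Degenerate `L` are reached by
perturbation and continuity.

The fourth equation also uses the dispersion relation: multiplication by `X ^ 3 + α₂ X ^ 2` acts on
each row of `L` as a scalar. With `-s`, `-t` the remaining roots of `g₃(X) = g₃(-a)`, the factor `(X
+ a)(X + s)(X + t)` therefore only rescales determinants, and `four_parameter` collapses to
`reducedRelation_eq_zero`.

The parameter `δ` is the translation `X ↦ X + δ`, which fixes `f` and adds `N δ f` to `g`. The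
passage between A2 and the bilinear system is rational algebra. -/

/-- The Casoratian with columns `L (r X ^ i)`, `i = 0, …, N - 1`. -/
noncomputable def tau {N : ℕ} (L : ℂ[X] →ₗ[ℂ] (Fin N → ℂ)) (r : ℂ[X]) : ℂ :=
  Matrix.det (Matrix.of fun j i : Fin N => L (r * X ^ (i : ℕ)) j)

/-- The Casoratian with columns `L (r X ^ i)`, `i = 0, …, N - 2, N`. -/
noncomputable def sigma {N : ℕ} (L : ℂ[X] →ₗ[ℂ] (Fin N → ℂ)) (r : ℂ[X]) : ℂ :=
  Matrix.det (Matrix.of fun j i : Fin N =>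
    L (r * X ^ (if (i : ℕ) + 1 = N then N else (i : ℕ))) j)

/-- Multiplication by `r` followed by `L`. -/
noncomputable def shiftBy {N : ℕ} (L : ℂ[X] →ₗ[ℂ] (Fin N → ℂ)) (r : ℂ[X]) :
    ℂ[X] →ₗ[ℂ] (Fin N → ℂ) :=
  L ∘ₗ LinearMap.mulLeft ℂ r

section Casoratian

variable {N : ℕ} (L : ℂ[X] →ₗ[ℂ] (Fin N → ℂ))

@[simp] theorem shiftBy_apply (r h : ℂ[X]) : shiftBy L r h = L (r * h) := rfl

theorem tau_shiftBy (r u : ℂ[X]) : tau (shiftBy L r) u = tau L (r * u) := by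
  simp [tau, mul_assoc]

theorem sigma_shiftBy (r u : ℂ[X]) : sigma (shiftBy L r) u = sigma L (r * u) := by
  simp [sigma, mul_assoc]

theorem map_eq_sum_range {n : ℕ} (h : ℂ[X]) (hn : h.natDegree < n) (j : Fin N) :
    L h j = ∑ i : Fin n, L (X ^ (i : ℕ)) j * h.coeff i := by
  conv_lhs => rw [h.as_sum_range' n hn]
  rw [map_sum, Finset.sum_apply, Finset.sum_range]
  refine Finset.sum_congr rfl fun i _ => ?_
  rw [← C_mul_X_pow_eq_monomial, ← smul_eq_C_mul, map_smul, Pi.smul_apply, smul_eq_mul, mul_comm]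

/-- A monic change of the polynomial basis does not change the determinant. -/
theorem det_monic_family (h : Fin N → ℂ[X]) (hd : ∀ i, (h i).natDegree = i)
    (hm : ∀ i, (h i).Monic) :
    Matrix.det (Matrix.of fun j i : Fin N => L (h i) j) = tau L 1 := by
  have : (Matrix.of fun j i : Fin N => L (h i) j) =
      (Matrix.of fun j i : Fin N => L (1 * X ^ (i : ℕ)) j) *
        Matrix.of (fun i j : Fin N => (h j).coeff i) := by
    ext j i
    simp only [Matrix.of_apply, Matrix.mul_apply, one_mul]
    exact map_eq_sum_range L (h i) (by rw [hd]; exact i.2) j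
  -- The matrix of coefficients is triangular with unit diagonal.
  rw [this, Matrix.det_mul, Matrix.det_matrixOfPolynomials h hd hm, mul_one, tau]

/-- A polynomial of degree less than `N` that is annihilated by a nondegenerate `L` vanishes. -/
theorem eq_zero_of_annihilated (hF : tau L 1 ≠ 0) (h : ℂ[X]) (hd : h.degree < N) (hL : L h = 0) :
    h = 0 := by
  rcases Nat.eq_zero_or_pos N with rfl | hN
  · simpa using hd
  have hd' : h.natDegree < N := by
    by_cases h0 : h = 0
    · simpa [h0] using hN
    · exact (natDegree_lt_iff_degree_lt h0).2 hd
  have hv : (Matrix.of fun j i : Fin N => L (1 * X ^ (i : ℕ)) j).mulVec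
      (fun i : Fin N => h.coeff i) = 0 := by
    ext j
    simp only [Matrix.mulVec, dotProduct, Matrix.of_apply, one_mul]
    rw [← map_eq_sum_range L h hd' j, hL]
  have h0 := Matrix.eq_zero_of_mulVec_eq_zero hF hv
  ext i
  by_cases hi : i < N
  · simpa using congrFun h0 ⟨i, hi⟩
  · rw [coeff_eq_zero_of_natDegree_lt (by omega), coeff_zero]

/-- A nondegenerate `L` annihilates a monic polynomial of degree `N`. -/
theorem exists_annihilator (hF : tau L 1 ≠ 0) :
    ∃ π : ℂ[X], π.Monic ∧ π.natDegree = N ∧ L π = 0 := by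
  set A : Matrix (Fin N) (Fin N) ℂ := Matrix.of fun j i : Fin N => L (1 * X ^ (i : ℕ)) j with hA
  have hu : IsUnit A.det := isUnit_iff_ne_zero.2 hF
  -- The coordinates of `L (X ^ N)` in the basis formed by the columns of `A`; subtracting this
  -- combination from `X ^ N` gives the annihilator.
  set c : Fin N → ℂ := A⁻¹.mulVec (L (X ^ N)) with hc
  have hAc : A.mulVec c = L (X ^ N) := by
    rw [hc, Matrix.mulVec_mulVec, Matrix.mul_nonsing_inv _ hu, Matrix.one_mulVec]
  set s : ℂ[X] := ∑ i : Fin N, c i • X ^ (i : ℕ) with hs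
  have hsd : s.degree < N := by
    refine (degree_sum_le _ _).trans_lt ((Finset.sup_lt_iff ?_).2 fun i _ => ?_)
    · exact WithBot.bot_lt_coe N
    · exact (degree_smul_le _ _).trans_lt (by rw [degree_X_pow]; exact_mod_cast i.2)
  refine ⟨X ^ N - s, ?_, ?_, ?_⟩
  · rw [sub_eq_add_neg]
    exact monic_X_pow_add (by rwa [degree_neg])
  · refine natDegree_eq_of_degree_eq_some ?_
    rw [degree_sub_eq_left_of_degree_lt] <;> rw [degree_X_pow]
    exact hsd
  · rw [map_sub, ← hAc, sub_eq_zero]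
    ext j
    simp [hs, hA, Matrix.mulVec, dotProduct, mul_comm]

end Casoratian

end BilinearA2

/-! ### Determinants expressed through the annihilator; the three-term relation. -/

namespace BilinearA2

open Polynomial Filter Topology

section Annihilator

variable {N : ℕ} (L : ℂ[X] →ₗ[ℂ] (Fin N → ℂ))

/-- Evaluation at a point, adjoined as a first row. -/
noncomputable def consEval (x : ℂ) : ℂ[X] →ₗ[ℂ] (Fin (N + 1) → ℂ) :=
  LinearMap.pi (Fin.cons (leval x) fun j => LinearMap.proj j ∘ₗ L)

@[simp] theorem consEval_zero (x : ℂ) (h : ℂ[X]) : consEval L x h 0 = h.eval x := rfl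

@[simp] theorem consEval_succ (x : ℂ) (h : ℂ[X]) (j : Fin N) :
    consEval L x h j.succ = L h j := rfl

/-- In the monic basis `1, (X + s) X ^ i`, evaluation at `-s` gives the first row `(1, 0, …, 0)`. -/
theorem tau_consEval_eq_tau (s : ℂ) : tau (consEval L (-s)) 1 = tau L (X + C s) := by
  rw [← det_monic_family (consEval L (-s))
    (Fin.cons 1 fun i : Fin N => (X + C s) * X ^ (i : ℕ)), Matrix.det_succ_row_zero,
    Fin.sum_univ_succ]
  · simp [tau, Matrix.submatrix]
  · refine Fin.cases (by simp) fun i => ?_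
    simp only [Fin.cons_succ]
    rw [(monic_X_add_C s).natDegree_mul (monic_X_pow _)]
    simp [add_comm]
  · refine Fin.cases (by simp) fun i => ?_
    simpa using (monic_X_add_C s).mul (monic_X_pow (i : ℕ))

/-- In the monic basis `1, X, …, X ^ (N - 1), π`, the last column is zero except for the evaluation
`π(-s)` on top. -/
theorem tau_consEval_eq_eval (s : ℂ) {π : ℂ[X]} (hm : π.Monic) (hd : π.natDegree = N)
    (hL : L π = 0) : tau (consEval L (-s)) 1 = (-1) ^ N * π.eval (-s) * tau L 1 := by
  rw [← det_monic_family (consEval L (-s))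
    (Fin.snoc (fun i : Fin N => X ^ (i : ℕ)) π), Matrix.det_succ_column _ (Fin.last N),
    Fin.sum_univ_succ]
  · simp [tau, Matrix.submatrix, hL]
  · refine Fin.lastCases (by simpa using hd) fun i => by simp
  · refine Fin.lastCases (by simpa using hm) fun i => by simp

/-- Value of the Casoratian shifted by one linear factor. -/
theorem tau_X_add_C (s : ℂ) {π : ℂ[X]} (hm : π.Monic) (hd : π.natDegree = N)
    (hL : L π = 0) : tau L (X + C s) = (-1) ^ N * π.eval (-s) * tau L 1 := by
  rw [← tau_consEval_eq_tau, tau_consEval_eq_eval L s hm hd hL]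

/-- Cramer's rule: `L π = 0` expands `L (X ^ N)` in the lower columns, and replacing the last column
by it multiplies the determinant by the last coordinate. -/
theorem sigma_one (hN : 0 < N) {π : ℂ[X]} (hm : π.Monic) (hd : π.natDegree = N)
    (hL : L π = 0) : sigma L 1 = - π.coeff (N - 1) * tau L 1 := by
  obtain ⟨M, rfl⟩ : ∃ M, N = M + 1 := ⟨N - 1, by omega⟩
  set A : Matrix (Fin (M + 1)) (Fin (M + 1)) ℂ := Matrix.of fun j i => L (1 * X ^ (i : ℕ)) j
    with hA
  have hX : L (X ^ (M + 1)) = A.mulVec (fun i => - π.coeff i) := by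
    have h1 : L (X ^ (M + 1)) = L (X ^ (M + 1) - π) := by rw [map_sub, hL, sub_zero]
    have h2 : (X ^ (M + 1) - π).natDegree < M + 1 := by
      have : (X ^ (M + 1) - π).degree < ((M + 1 : ℕ) : WithBot ℕ) := by
        have := degree_sub_lt_left (p := (X ^ (M + 1) : ℂ[X])) (q := π)
          (by rw [degree_X_pow, degree_eq_natDegree hm.ne_zero, hd]) (by simp)
          (by rw [hm.leadingCoeff, (monic_X_pow _).leadingCoeff])
        rwa [degree_X_pow] at this
      by_cases h0 : X ^ (M + 1) - π = 0
      · simp [h0]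
      · exact (natDegree_lt_iff_degree_lt h0).2 this
    ext j
    rw [h1, map_eq_sum_range L _ h2 j]
    simp only [Matrix.mulVec, dotProduct, hA, Matrix.of_apply, one_mul]
    refine Finset.sum_congr rfl fun i _ => ?_
    rw [coeff_sub, coeff_X_pow, if_neg (by have := i.2; omega), zero_sub]
  have hS : sigma L 1 = (A.updateCol (Fin.last M) (L (X ^ (M + 1)))).det := by
    rw [sigma]
    congr 1
    ext j i
    refine Fin.lastCases ?_ (fun i => ?_) i
    · simp
    · have := i.2
      rw [Matrix.updateCol_ne (Fin.castSucc_lt_last i).ne]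
      simp [hA, this.ne]
  rw [hS, ← Matrix.cramer_apply, Matrix.cramer_eq_adjugate_mulVec, hX, Matrix.mulVec_mulVec,
    Matrix.adjugate_mul]
  simp [Matrix.smul_mulVec, tau, hA, mul_comm]

/-- Three-term relation, for nondegenerate Casoratians. -/
theorem three_term_of_ne_zero (hN : 0 < N) (s t : ℂ) (hF : tau L 1 ≠ 0)
    (hs : tau L (X + C s) ≠ 0) (ht : tau L (X + C t) ≠ 0) :
    tau L (X + C s) * sigma L (X + C t) - tau L (X + C t) * sigma L (X + C s)
      + (s - t) * (tau L (X + C s) * tau L (X + C t)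
        - tau L 1 * tau L ((X + C s) * (X + C t))) = 0 := by
  obtain ⟨π, hm, hd, hL⟩ := exists_annihilator L hF
  obtain ⟨πs, hms, hds, hLs⟩ := exists_annihilator (shiftBy L (X + C s))
    (by rwa [tau_shiftBy, mul_one])
  obtain ⟨πt, hmt, hdt, hLt⟩ := exists_annihilator (shiftBy L (X + C t))
    (by rwa [tau_shiftBy, mul_one])
  have es := tau_X_add_C L s hm hd hL
  have et := tau_X_add_C L t hm hd hL
  have est := tau_X_add_C (shiftBy L (X + C s)) t hms hds hLs
  have gs := sigma_one (shiftBy L (X + C s)) hN hms hds hLs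
  have gt := sigma_one (shiftBy L (X + C t)) hN hmt hdt hLt
  rw [tau_shiftBy, tau_shiftBy, mul_one] at est
  rw [sigma_shiftBy, tau_shiftBy, mul_one] at gs gt
  rw [shiftBy_apply] at hLs hLt
  set lam : ℂ := t + πt.coeff (N - 1) - s - πs.coeff (N - 1) with hlam
  -- All three terms are killed by `L`. The leading terms of the first two cancel, and `lam` is the
  -- coefficient of `X ^ N` in their difference, so degree less than `N` remains.
  have key : (X + C t) * πt - (X + C s) * πs - C lam * π = 0 := by
    refine eq_zero_of_annihilated L hF _ ?_ ?_
    · rw [degree_lt_iff_coeff_zero]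
      intro k hk
      obtain ⟨M, rfl⟩ : ∃ M, N = M + 1 := ⟨N - 1, by omega⟩
      obtain ⟨k, rfl⟩ : ∃ k', k = k' + 1 := ⟨k - 1, by omega⟩
      have c1 : ∀ q : ℂ[X], q.Monic → q.natDegree = M + 1 → q.coeff (M + 1) = 1 := by
        intro q h1 h2
        rw [← h2]
        exact h1
      simp only [add_mul, coeff_sub, coeff_add, coeff_X_mul, coeff_C_mul]
      rcases Nat.lt_or_ge M k with h | h
      · rcases Nat.lt_or_ge (M + 1) k with h' | h'
        · rw [coeff_eq_zero_of_natDegree_lt (p := πt) (by omega),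
            coeff_eq_zero_of_natDegree_lt (p := πs) (by omega),
            coeff_eq_zero_of_natDegree_lt (p := πt) (by omega),
            coeff_eq_zero_of_natDegree_lt (p := πs) (by omega),
            coeff_eq_zero_of_natDegree_lt (p := π) (by omega)]
          ring
        · obtain rfl : k = M + 1 := by omega
          rw [c1 _ hmt hdt, c1 _ hms hds, coeff_eq_zero_of_natDegree_lt (p := πt) (by omega),
            coeff_eq_zero_of_natDegree_lt (p := πs) (by omega),
            coeff_eq_zero_of_natDegree_lt (p := π) (by omega)]
          ring
      · obtain rfl : k = M := by omega
        rw [c1 _ hmt hdt, c1 _ hms hds, c1 _ hm hd, hlam]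
        simp
        ring
    · rw [map_sub, map_sub, hLs, hLt, ← smul_eq_C_mul, map_smul, hL]
      simp
  -- At `-t` the term with `πt` vanishes, leaving `πs(-t)` and `π(-t)`, which are the data in `est`
  -- and `et`.
  have ht' := congrArg (eval (-t)) key
  simp only [eval_sub, eval_mul, eval_add, eval_X, eval_C, eval_zero] at ht'
  rw [gs, gt, est, et]
  linear_combination (-1) ^ N * tau L 1 * tau L (X + C s) * ht' +
    (-1) ^ N * tau L 1 * tau L (X + C s) * π.eval (-t) * hlam

end Annihilator

end BilinearA2

/-! ### Removal of nondegeneracy; the four-parameter relation. -/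

namespace BilinearA2

open Polynomial Filter Topology

section Density

variable {N : ℕ} (L : ℂ[X] →ₗ[ℂ] (Fin N → ℂ))

/-- Evaluation at the points `x j`. -/
noncomputable def evalAt (x : Fin N → ℂ) : ℂ[X] →ₗ[ℂ] (Fin N → ℂ) :=
  LinearMap.pi fun j => leval (x j)

@[simp] theorem evalAt_apply (x : Fin N → ℂ) (h : ℂ[X]) (j : Fin N) :
    evalAt x h j = h.eval (x j) := rfl

theorem tau_evalAt (x : Fin N → ℂ) (r : ℂ[X]) :
    tau (evalAt x) r = (∏ j, r.eval (x j)) * (Matrix.vandermonde x).det := by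
  rw [← Matrix.det_mul_column]
  simp [tau, Matrix.vandermonde]

theorem eventually_eval_ne_zero {P : ℂ[X]} (hP : P ≠ 0) (x : ℂ) :
    ∀ᶠ ε in 𝓝[≠] x, P.eval ε ≠ 0 := by
  have hfin : {ε : ℂ | P.IsRoot ε}.Finite := Polynomial.finite_setOfPred_isRoot hP
  have h := (hfin.subset Set.sdiff_subset : ({ε : ℂ | P.IsRoot ε} \ {x}).Finite).isClosed
  have h' := h.isOpen_compl.mem_nhds (x := x) (by simp)
  filter_upwards [nhdsWithin_le_nhds h', self_mem_nhdsWithin] with ε h1 h2 h3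
  exact h1 ⟨h3, h2⟩

/-- `L` can be perturbed so that all Casoratians with factors dividing `R` become nonzero. -/
theorem exists_perturbation (R : ℂ[X]) (hR : R ≠ 0) :
    ∃ D : ℂ[X] →ₗ[ℂ] (Fin N → ℂ), ∀ r, r ∣ R →
      ∀ᶠ ε in 𝓝[≠] (0 : ℂ), tau (L + ε • D) r ≠ 0 := by
  have hinf : {x : ℂ | R.IsRoot x}ᶜ.Infinite :=
    (Polynomial.finite_setOfPred_isRoot hR).infinite_compl
  -- `D` evaluates at `N` distinct points that are not roots of `R`, so one `D` serves all divisors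
  -- of `R`.
  set e := hinf.natEmbedding
  refine ⟨evalAt fun j : Fin N => (e j : ℂ), fun r hr => ?_⟩
  set x : Fin N → ℂ := fun j => (e j : ℂ) with hx
  have hxi : Function.Injective x := fun i j h => Fin.ext (e.injective (Subtype.ext h))
  have hr0 : ∀ j, r.eval (x j) ≠ 0 := fun j h => (e j).2 ((show r.IsRoot (x j) from h).dvd hr)
  set A : Matrix (Fin N) (Fin N) ℂ := Matrix.of fun j i => evalAt x (r * X ^ (i : ℕ)) j
  set B : Matrix (Fin N) (Fin N) ℂ := Matrix.of fun j i => L (r * X ^ (i : ℕ)) j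
  have hA : A.det ≠ 0 := by
    rw [show A.det = tau (evalAt x) r from rfl, tau_evalAt]
    exact mul_ne_zero (Finset.prod_ne_zero_iff.2 fun j _ => hr0 j)
      (Matrix.det_vandermonde_ne_zero_iff.2 hxi)
  -- The perturbed determinant is a polynomial in `ε` whose coefficient of `ε ^ N` is `A.det`.
  have hP : ((X : ℂ[X]) • A.map C + B.map C).det ≠ 0 := by
    intro h
    have := Polynomial.coeff_det_X_add_C_card A B
    rw [h, coeff_zero] at this
    exact hA this.symm
  filter_upwards [eventually_eval_ne_zero hP 0] with ε hε
  convert hε using 1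
  rw [← coe_evalRingHom, RingHom.map_det, tau]
  congr 1
  ext j i
  simp [A, B, add_comm]

theorem continuous_det_perturbation (D : ℂ[X] →ₗ[ℂ] (Fin N → ℂ)) (r : Fin N → ℂ[X]) :
    Continuous fun ε : ℂ => (Matrix.of fun j i : Fin N => (L + ε • D) (r i) j).det := by
  refine Continuous.matrix_det ?_
  refine continuous_matrix fun i j => ?_
  simp only [Matrix.of_apply, LinearMap.add_apply, LinearMap.smul_apply, Pi.add_apply,
    Pi.smul_apply]
  fun_prop

@[fun_prop]
theorem continuous_tau_perturbation (D : ℂ[X] →ₗ[ℂ] (Fin N → ℂ)) (r : ℂ[X]) :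
    Continuous fun ε : ℂ => tau (L + ε • D) r :=
  continuous_det_perturbation L D _

@[fun_prop]
theorem continuous_sigma_perturbation (D : ℂ[X] →ₗ[ℂ] (Fin N → ℂ)) (r : ℂ[X]) :
    Continuous fun ε : ℂ => sigma (L + ε • D) r :=
  continuous_det_perturbation L D _

theorem eq_zero_of_eventually {φ : ℂ → ℂ} {x : ℂ} (hφ : ContinuousAt φ x)
    (h : ∀ᶠ ε in 𝓝[≠] x, φ ε = 0) : φ x = 0 :=
  tendsto_nhds_unique (hφ.tendsto.mono_left nhdsWithin_le_nhds)
    (tendsto_const_nhds.congr' (h.mono fun _ h => h.symm))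

/-- Three-term relation. -/
theorem three_term (hN : 0 < N) (s t : ℂ) :
    tau L (X + C s) * sigma L (X + C t) - tau L (X + C t) * sigma L (X + C s)
      + (s - t) * (tau L (X + C s) * tau L (X + C t)
        - tau L 1 * tau L ((X + C s) * (X + C t))) = 0 := by
  obtain ⟨D, hD⟩ := exists_perturbation L ((X + C s) * (X + C t))
    ((monic_X_add_C s).mul (monic_X_add_C t)).ne_zero
  have h := eq_zero_of_eventually (x := 0) (φ := fun ε : ℂ =>
    tau (L + ε • D) (X + C s) * sigma (L + ε • D) (X + C t)
      - tau (L + ε • D) (X + C t) * sigma (L + ε • D) (X + C s)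
      + (s - t) * (tau (L + ε • D) (X + C s) * tau (L + ε • D) (X + C t)
        - tau (L + ε • D) 1 * tau (L + ε • D) ((X + C s) * (X + C t))))
    (Continuous.continuousAt (by fun_prop)) (by
      filter_upwards [hD 1 (one_dvd _), hD _ (dvd_mul_right _ _), hD _ (dvd_mul_left _ _)]
        with ε h1 h2 h3
      exact three_term_of_ne_zero _ hN s t h1 h2 h3)
  simpa using h

theorem three_term_shift (hN : 0 < N) (r : ℂ[X]) (s t : ℂ) :
    tau L (r * (X + C s)) * sigma L (r * (X + C t))
      - tau L (r * (X + C t)) * sigma L (r * (X + C s))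
      + (s - t) * (tau L (r * (X + C s)) * tau L (r * (X + C t))
        - tau L r * tau L (r * ((X + C s) * (X + C t)))) = 0 := by
  have h := three_term (shiftBy L r) hN s t
  simpa only [tau_shiftBy, sigma_shiftBy, mul_one] using h

/-- In the cyclic sum of three three-term relations all `sigma` terms and the triple products of
`tau` cancel, leaving a multiple of `tau L 1`. -/
theorem hirota_miwa_of_ne_zero (hN : 0 < N) (p q s : ℂ) (hF : tau L 1 ≠ 0) :
    (p - q) * tau L (X + C s) * tau L ((X + C p) * (X + C q))
      + (q - s) * tau L (X + C p) * tau L ((X + C q) * (X + C s))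
      + (s - p) * tau L (X + C q) * tau L ((X + C s) * (X + C p)) = 0 := by
  have h1 := three_term L hN p q
  have h2 := three_term L hN q s
  have h3 := three_term L hN s p
  refine (mul_eq_zero.1 ?_).resolve_left hF
  linear_combination -tau L (X + C s) * h1 - tau L (X + C p) * h2 - tau L (X + C q) * h3

/-- The four-parameter relation, for nondegenerate Casoratians. -/
theorem four_parameter_of_ne_zero (hN : 0 < N) (p q s t : ℂ) (hF : tau L 1 ≠ 0)
    (hs : tau L (X + C s) ≠ 0) (hsp : tau L ((X + C s) * (X + C p)) ≠ 0) :
    (p - q) * ((p + q - s - t) * tau L ((X + C s) * (X + C t)) * tau L ((X + C p) * (X + C q))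
        + sigma L ((X + C s) * (X + C t)) * tau L ((X + C p) * (X + C q))
        - sigma L ((X + C p) * (X + C q)) * tau L ((X + C s) * (X + C t)))
      - (p - s) * (p - t) * tau L (X + C q) * tau L ((X + C p) * ((X + C s) * (X + C t)))
      + (q - s) * (q - t) * tau L (X + C p) * tau L ((X + C q) * ((X + C s) * (X + C t)))
      = 0 := by
  have h1 := three_term_shift L hN (X + C s) t p
  have h2 := three_term_shift L hN (X + C p) s q
  have h3 := hirota_miwa_of_ne_zero L hN p q s hF
  have h4 := hirota_miwa_of_ne_zero (shiftBy L (X + C s)) hN p q t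
    (by rwa [tau_shiftBy, mul_one])
  simp only [tau_shiftBy] at h4
  rw [show (X + C p) * ((X + C s) * (X + C t)) = (X + C s) * ((X + C p) * (X + C t)) by ring,
    show (X + C q) * ((X + C s) * (X + C t)) = (X + C s) * ((X + C q) * (X + C t)) by ring]
  rw [mul_comm (X + C t) (X + C p)] at h1 h4
  rw [mul_comm (X + C p) (X + C s),
    show (X + C p) * ((X + C s) * (X + C q)) = (X + C s) * ((X + C p) * (X + C q)) by ring] at h2
  rw [mul_comm (X + C q) (X + C s)] at h3
  refine (mul_eq_zero.1 ?_).resolve_left hsp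
  -- `h1` and `h2` share `sigma L ((X + C s) * (X + C p))`, which their combination eliminates; `h3`
  -- and `h4` then rearrange the products of `tau`.
  linear_combination -(p - q) * tau L ((X + C p) * (X + C q)) * h1
    - (p - q) * tau L ((X + C s) * (X + C t)) * h2
    + (p - t) * tau L ((X + C s) * ((X + C p) * (X + C t))) * h3
    + (q - s) * tau L (X + C p) * h4

/-- The four-parameter relation. -/
theorem four_parameter (hN : 0 < N) (p q s t : ℂ) :
    (p - q) * ((p + q - s - t) * tau L ((X + C s) * (X + C t)) * tau L ((X + C p) * (X + C q))
        + sigma L ((X + C s) * (X + C t)) * tau L ((X + C p) * (X + C q))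
        - sigma L ((X + C p) * (X + C q)) * tau L ((X + C s) * (X + C t)))
      - (p - s) * (p - t) * tau L (X + C q) * tau L ((X + C p) * ((X + C s) * (X + C t)))
      + (q - s) * (q - t) * tau L (X + C p) * tau L ((X + C q) * ((X + C s) * (X + C t)))
      = 0 := by
  obtain ⟨D, hD⟩ := exists_perturbation L ((X + C s) * (X + C p))
    ((monic_X_add_C s).mul (monic_X_add_C p)).ne_zero
  have h := eq_zero_of_eventually (x := 0) (φ := fun ε : ℂ =>
    (p - q) * ((p + q - s - t) * tau (L + ε • D) ((X + C s) * (X + C t))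
          * tau (L + ε • D) ((X + C p) * (X + C q))
        + sigma (L + ε • D) ((X + C s) * (X + C t)) * tau (L + ε • D) ((X + C p) * (X + C q))
        - sigma (L + ε • D) ((X + C p) * (X + C q)) * tau (L + ε • D) ((X + C s) * (X + C t)))
      - (p - s) * (p - t) * tau (L + ε • D) (X + C q)
        * tau (L + ε • D) ((X + C p) * ((X + C s) * (X + C t)))
      + (q - s) * (q - t) * tau (L + ε • D) (X + C p)
        * tau (L + ε • D) ((X + C q) * ((X + C s) * (X + C t))))
    (Continuous.continuousAt (by fun_prop)) (by
      filter_upwards [hD 1 (one_dvd _), hD _ (dvd_mul_right _ _), hD _ dvd_rfl] with ε h1 h2 h3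
      exact four_parameter_of_ne_zero _ hN p q s t h1 h2 h3)
  simpa using h

end Density

end BilinearA2

/-! ### The cubic reduction. -/

namespace BilinearA2

open Polynomial Filter Topology

section Reduction

variable {N : ℕ} (L : ℂ[X] →ₗ[ℂ] (Fin N → ℂ))

/-- If multiplication by `c` acts on `L` row by row, it acts on Casoratians as a scalar. -/
theorem tau_mul_of_scaling {c : ℂ[X]} {κ : Fin N → ℂ} (hc : ∀ h j, L (c * h) j = κ j * L h j)
    (r : ℂ[X]) : tau L (c * r) = (∏ j, κ j) * tau L r := by
  rw [tau, tau, ← Matrix.det_mul_column]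
  simp [mul_assoc, hc]

theorem sigma_mul_of_scaling {c : ℂ[X]} {κ : Fin N → ℂ} (hc : ∀ h j, L (c * h) j = κ j * L h j)
    (r : ℂ[X]) : sigma L (c * r) = (∏ j, κ j) * sigma L r := by
  rw [sigma, sigma, ← Matrix.det_mul_column]
  simp only [mul_assoc, hc, Matrix.of_apply]

/-- Left-hand side of the relation satisfied by 3-reduced Casoratians. -/
noncomputable def reducedRelation (α₂ p q a : ℂ) : ℂ :=
  (p - q) * (((p + q + a - α₂) * tau L 1 + sigma L 1)
        * tau L ((X + C a) * ((X + C p) * (X + C q)))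
      - sigma L ((X + C a) * ((X + C p) * (X + C q))) * tau L 1)
    - (p ^ 2 + p * a + a ^ 2 - α₂ * (p + a)) * tau L ((X + C a) * (X + C q)) * tau L (X + C p)
    + (q ^ 2 + q * a + a ^ 2 - α₂ * (q + a)) * tau L ((X + C a) * (X + C p)) * tau L (X + C q)

theorem reducedRelation_eq_zero_of_ne (hN : 0 < N) {α₂ : ℂ} {κ : Fin N → ℂ}
    (hκ : ∀ h j, L ((X ^ 3 + C α₂ * X ^ 2) * h) j = κ j * L h j) (p q a : ℂ)
    (ha : ∀ j, κ j ≠ -a ^ 3 + α₂ * a ^ 2) : reducedRelation L α₂ p q a = 0 := by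
  -- These conditions say `(X + a)(X + s)(X + t) = g₃(X) - g₃(-a)`. They also turn `(p - s)(p - t)`
  -- into `p_a` and `p + q - s - t` into `p + q + a - α₂`.
  obtain ⟨s, t, hs, ht⟩ : ∃ s t : ℂ, s + t = α₂ - a ∧ s * t = a ^ 2 - α₂ * a := by
    obtain ⟨d, hd⟩ := IsAlgClosed.exists_pow_nat_eq ((α₂ - a) ^ 2 - 4 * (a ^ 2 - α₂ * a))
      two_pos
    exact ⟨(α₂ - a + d) / 2, (α₂ - a - d) / 2, by ring, by linear_combination -hd / 4⟩
  have hc : ∀ h j, L (((X + C a) * ((X + C s) * (X + C t))) * h) j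
      = (κ j - (-a ^ 3 + α₂ * a ^ 2)) * L h j := by
    intro h j
    have e : (X + C a) * ((X + C s) * (X + C t))
        = X ^ 3 + C α₂ * X ^ 2 - C (-a ^ 3 + α₂ * a ^ 2) := by
      have h1 : (C s + C t : ℂ[X]) = C α₂ - C a := by rw [← C_add, hs, C_sub]
      have h2 : (C s * C t : ℂ[X]) = C a ^ 2 - C α₂ * C a := by rw [← C_mul, ht]; simp
      simp only [C_add, C_mul, C_neg, C_pow]
      linear_combination (X + C a) * X * h1 + (X + C a) * h2
    rw [e, sub_mul, map_sub, Pi.sub_apply, hκ, ← smul_eq_C_mul, map_smul, Pi.smul_apply,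
      smul_eq_mul]
    ring
  have hθ : (∏ j, (κ j - (-a ^ 3 + α₂ * a ^ 2))) ≠ 0 :=
    Finset.prod_ne_zero_iff.2 fun j _ => sub_ne_zero.2 (ha j)
  have h := four_parameter (shiftBy L (X + C a)) hN p q s t
  have t1 := tau_mul_of_scaling L hc 1
  have t2 := sigma_mul_of_scaling L hc 1
  have t3 := tau_mul_of_scaling L hc (X + C p)
  have t4 := tau_mul_of_scaling L hc (X + C q)
  simp only [tau_shiftBy, sigma_shiftBy] at h
  rw [mul_one] at t1 t2
  rw [show (X + C a) * ((X + C p) * ((X + C s) * (X + C t)))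
      = (X + C a) * ((X + C s) * (X + C t)) * (X + C p) by ring,
    show (X + C a) * ((X + C q) * ((X + C s) * (X + C t)))
      = (X + C a) * ((X + C s) * (X + C t)) * (X + C q) by ring, t1, t2, t3, t4] at h
  refine (mul_eq_zero.1 ?_).resolve_left hθ
  rw [reducedRelation]
  set θ := ∏ j, (κ j - (-a ^ 3 + α₂ * a ^ 2))
  linear_combination h
    + (p - q) * θ * tau L 1 * tau L ((X + C a) * ((X + C p) * (X + C q))) * hs
    - θ * tau L ((X + C a) * (X + C q)) * tau L (X + C p) * (p * hs - ht)
    + θ * tau L ((X + C a) * (X + C p)) * tau L (X + C q) * (q * hs - ht)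

theorem continuous_det_X_add_C_mul (u : Fin N → ℂ[X]) :
    Continuous fun a : ℂ => (Matrix.of fun j i : Fin N => L ((X + C a) * u i) j).det := by
  refine Continuous.matrix_det (continuous_matrix fun i j => ?_)
  simp only [Matrix.of_apply, add_mul, map_add, ← smul_eq_C_mul, map_smul, Pi.add_apply,
    Pi.smul_apply]
  fun_prop

@[fun_prop]
theorem continuous_tau_X_add_C_mul (r : ℂ[X]) :
    Continuous fun a : ℂ => tau L ((X + C a) * r) := by
  simp only [tau, mul_assoc]
  exact continuous_det_X_add_C_mul L _

@[fun_prop]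
theorem continuous_sigma_X_add_C_mul (r : ℂ[X]) :
    Continuous fun a : ℂ => sigma L ((X + C a) * r) := by
  simp only [sigma, mul_assoc]
  exact continuous_det_X_add_C_mul L _

/-- The relation is continuous in `a`, and each exceptional equation `κ j = g₃(-a)` has finitely
many solutions `a`. -/
theorem reducedRelation_eq_zero (hN : 0 < N) {α₂ : ℂ} {κ : Fin N → ℂ}
    (hκ : ∀ h j, L ((X ^ 3 + C α₂ * X ^ 2) * h) j = κ j * L h j) (p q a : ℂ) :
    reducedRelation L α₂ p q a = 0 := by
  refine eq_zero_of_eventually (φ := fun a => reducedRelation L α₂ p q a) ?_ ?_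
  · unfold reducedRelation
    exact Continuous.continuousAt (by fun_prop)
  · have hP : ∀ j, ∀ᶠ x in 𝓝[≠] a, κ j ≠ -x ^ 3 + α₂ * x ^ 2 := by
      intro j
      set P : ℂ[X] := X ^ 3 - C α₂ * X ^ 2 + C (κ j) with hPdef
      have h0 : P ≠ 0 := by
        intro h
        have := congrArg (fun f : ℂ[X] => f.coeff 3) h
        simp [hPdef, coeff_X_pow] at this
      filter_upwards [eventually_eval_ne_zero h0 a] with x hx h
      refine hx ?_
      simp only [hPdef, eval_add, eval_sub, eval_mul, eval_pow, eval_X, eval_C]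
      linear_combination h
    filter_upwards [eventually_all.2 hP] with x hx
    exact reducedRelation_eq_zero_of_ne L hN hκ p q x hx

end Reduction

end BilinearA2

/-! ### Translation of the polynomial variable by `δ`. -/

namespace BilinearA2

open Polynomial Filter Topology

section Translation

variable {N : ℕ} (L : ℂ[X] →ₗ[ℂ] (Fin N → ℂ))

/-- Precomposition of `L` with the translation `X ↦ X + δ`. -/
noncomputable def translateBy (δ : ℂ) : ℂ[X] →ₗ[ℂ] (Fin N → ℂ) := L ∘ₗ taylor δ

@[simp] theorem translateBy_apply (δ : ℂ) (h : ℂ[X]) :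
    translateBy L δ h = L (taylor δ h) := rfl

theorem translateBy_zero : translateBy L 0 = L :=
  LinearMap.ext fun h => by rw [translateBy_apply, taylor_zero]

theorem tau_translateBy (δ : ℂ) : tau (translateBy L δ) 1 = tau L 1 := by
  rw [← det_monic_family L (fun i => (X + C δ) ^ (i : ℕ))
    (fun i => by rw [(monic_X_add_C δ).natDegree_pow]; simp)
    (fun i => (monic_X_add_C δ).pow _)]
  simp [tau]

theorem coeff_taylor_pred {π : ℂ[X]} {M : ℕ} (hm : π.Monic) (hd : π.natDegree = M + 1) (δ : ℂ) :
    (taylor δ π).coeff M = π.coeff M + (M + 1) * δ := by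
  have h1 : (hasseDeriv M π).natDegree < 2 := by
    have := natDegree_hasseDeriv_le π M
    omega
  have h2 : π.coeff (M + 1) = 1 := by rw [← hd]; exact hm
  rw [taylor_coeff, eval_eq_sum_range' h1]
  simp [Finset.sum_range_succ, hasseDeriv_coeff, add_comm 1 M, h2]

/-- The translated map kills `π(X - δ)`, whose subleading coefficient is lower by `N δ`. -/
theorem sigma_translateBy_of_ne_zero (hN : 0 < N) (δ : ℂ) (hF : tau L 1 ≠ 0) :
    sigma (translateBy L δ) 1 = sigma L 1 + N * δ * tau L 1 := by
  obtain ⟨M, rfl⟩ : ∃ M, N = M + 1 := ⟨N - 1, by omega⟩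
  obtain ⟨π, hm, hd, hL⟩ := exists_annihilator L hF
  rw [sigma_one L hN hm hd hL,
    sigma_one (translateBy L δ) hN (π := taylor (-δ) π)
      (by rw [Monic, leadingCoeff_taylor]; exact hm) (by rw [natDegree_taylor, hd])
      (by simp [taylor_taylor, hL]),
    tau_translateBy, Nat.add_sub_cancel, coeff_taylor_pred hm hd]
  push_cast
  ring

theorem sigma_translateBy (hN : 0 < N) (δ : ℂ) :
    sigma (translateBy L δ) 1 = sigma L 1 + N * δ * tau L 1 := by
  obtain ⟨D, hD⟩ := exists_perturbation L 1 one_ne_zero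
  have hT : ∀ ε : ℂ, translateBy (L + ε • D) δ = translateBy L δ + ε • translateBy D δ :=
    fun ε => rfl
  have h := eq_zero_of_eventually (x := 0) (φ := fun ε : ℂ =>
    sigma (translateBy L δ + ε • translateBy D δ) 1
      - (sigma (L + ε • D) 1 + N * δ * tau (L + ε • D) 1))
    (Continuous.continuousAt (by fun_prop)) (by
      filter_upwards [hD 1 dvd_rfl] with ε h1
      rw [← hT, sigma_translateBy_of_ne_zero _ hN δ h1, sub_self])
  exact sub_eq_zero.1 (by simpa using h)

end Translation

/-! ### The Casoratian entries as a linear map; proof of the bilinear equations. -/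

section Entries

variable {N : ℕ} (p q a b : ℂ) (ω ϱ : Fin N → Fin 3 → ℂ) (β : ℤ)

/-- `h ↦ ∑ₛ h(-ωₛ) (p - ωₛ)^n (q - ωₛ)^m (a - ωₛ)^α (b - ωₛ)^β ϱ_{j,s}`. -/
noncomputable def moments (n m α : ℤ) : ℂ[X] →ₗ[ℂ] (Fin N → ℂ) :=
  LinearMap.pi fun j => ∑ s : Fin 3, ((p - ω j s) ^ n * (q - ω j s) ^ m * (a - ω j s) ^ α
    * (b - ω j s) ^ β * ϱ j s) • leval (-ω j s)

theorem moments_apply (n m α : ℤ) (h : ℂ[X]) (j : Fin N) :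
    moments p q a b ω ϱ β n m α h j = ∑ s : Fin 3, (p - ω j s) ^ n * (q - ω j s) ^ m
      * (a - ω j s) ^ α * (b - ω j s) ^ β * ϱ j s * h.eval (-ω j s) := by
  simp [moments]

theorem entry_natCast (δ : ℂ) (n m α : ℤ) (j : Fin N) (l : ℕ) :
    entry δ p q a b ω ϱ n m α β j l
      = translateBy (moments p q a b ω ϱ β n m α) δ (X ^ l) j := by
  rw [entry, translateBy_apply, moments_apply]
  refine Finset.sum_congr rfl fun s _ => ?_
  simp only [taylor_X_pow, eval_pow, eval_add, eval_X, eval_C, zpow_natCast]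
  rw [neg_add_eq_sub]
  ring

theorem casF_eq_tau_translateBy (δ : ℂ) (n m α : ℤ) :
    casF δ p q a b ω ϱ β n m α = tau (translateBy (moments p q a b ω ϱ β n m α) δ) 1 := by
  simp only [casF, casoratian, colsF, tau, entry_natCast, one_mul]

theorem casG_eq_sigma_translateBy (δ : ℂ) (n m α : ℤ) :
    casG δ p q a b ω ϱ β n m α = sigma (translateBy (moments p q a b ω ϱ β n m α) δ) 1 := by
  simp only [casG, casoratian, colsG, sigma, one_mul, ← Nat.cast_ite, entry_natCast]

theorem casF_eq_tau (n m α : ℤ) :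
    casF 0 p q a b ω ϱ β n m α = tau (moments p q a b ω ϱ β n m α) 1 := by
  rw [casF_eq_tau_translateBy, translateBy_zero]

theorem casG_eq_sigma (n m α : ℤ) :
    casG 0 p q a b ω ϱ β n m α = sigma (moments p q a b ω ϱ β n m α) 1 := by
  rw [casG_eq_sigma_translateBy, translateBy_zero]

theorem casF_delta (δ : ℂ) : casF δ p q a b ω ϱ β = casF 0 p q a b ω ϱ β := by
  funext n m α
  rw [casF_eq_tau_translateBy, tau_translateBy, casF_eq_tau]

theorem casG_delta (hN : 0 < N) (δ : ℂ) : casG δ p q a b ω ϱ β =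
    fun n m α => casG 0 p q a b ω ϱ β n m α + N * δ * casF 0 p q a b ω ϱ β n m α := by
  funext n m α
  rw [casG_eq_sigma_translateBy, sigma_translateBy _ hN, casF_eq_tau, casG_eq_sigma]

variable {p q a ω}

theorem moments_add_one_left (hp : ∀ j s, p ≠ ω j s) (n m α : ℤ) :
    moments p q a b ω ϱ β (n + 1) m α = shiftBy (moments p q a b ω ϱ β n m α) (X + C p) := by
  refine LinearMap.ext fun h => funext fun j => ?_
  rw [shiftBy_apply, moments_apply, moments_apply]
  refine Finset.sum_congr rfl fun s _ => ?_
  rw [zpow_add_one₀ (sub_ne_zero.2 (hp j s))]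
  simp only [eval_mul, eval_add, eval_X, eval_C]
  ring

theorem moments_add_one_mid (hq : ∀ j s, q ≠ ω j s) (n m α : ℤ) :
    moments p q a b ω ϱ β n (m + 1) α = shiftBy (moments p q a b ω ϱ β n m α) (X + C q) := by
  refine LinearMap.ext fun h => funext fun j => ?_
  rw [shiftBy_apply, moments_apply, moments_apply]
  refine Finset.sum_congr rfl fun s _ => ?_
  rw [zpow_add_one₀ (sub_ne_zero.2 (hq j s))]
  simp only [eval_mul, eval_add, eval_X, eval_C]
  ring

theorem moments_eq_shiftBy_sub_one (ha : ∀ j s, a ≠ ω j s) (n m α : ℤ) :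
    moments p q a b ω ϱ β n m α
      = shiftBy (moments p q a b ω ϱ β n m (α - 1)) (X + C a) := by
  refine LinearMap.ext fun h => funext fun j => ?_
  rw [shiftBy_apply, moments_apply, moments_apply]
  refine Finset.sum_congr rfl fun s _ => ?_
  obtain ⟨γ, rfl⟩ : ∃ γ, α = γ + 1 := ⟨α - 1, by ring⟩
  rw [zpow_add_one₀ (sub_ne_zero.2 (ha j s)), add_sub_cancel_right]
  simp only [eval_mul, eval_add, eval_X, eval_C]
  ring

/-- The only use of the dispersion relation: the cubic takes one common value at the three points
`-ω j s`. -/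
theorem moments_cubic {α₂ : ℂ} {k : Fin N → ℂ} (hω : IsDispersion α₂ k ω) (n m α : ℤ)
    (h : ℂ[X]) (j : Fin N) :
    moments p q a b ω ϱ β n m α ((X ^ 3 + C α₂ * X ^ 2) * h) j
      = g3 α₂ (-k j) * moments p q a b ω ϱ β n m α h j := by
  rw [moments_apply, moments_apply, Finset.mul_sum]
  refine Finset.sum_congr rfl fun s _ => ?_
  rw [← (hω j).2 s, g3]
  simp only [eval_mul, eval_add, eval_X, eval_C, eval_pow]
  ring

theorem subA_eq {α₂ a p : ℂ} (hpa : p ≠ a) :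
    subA α₂ a p = p ^ 2 + p * a + a ^ 2 - α₂ * (p + a) := by
  rw [subA, div_eq_iff (sub_ne_zero.2 hpa), latticeP, G3, g3, g3]
  ring

theorem casoratian_solvesBilinearAt (hN : 0 < N) {α₂ : ℂ} {k : Fin N → ℂ}
    (hω : IsDispersion α₂ k ω) (hp : ∀ j s, p ≠ ω j s) (hq : ∀ j s, q ≠ ω j s)
    (ha : ∀ j s, a ≠ ω j s) (hpa : p ≠ a) (hqa : q ≠ a) (n m α : ℤ) :
    SolvesBilinearAt α₂ p q a (casF 0 p q a b ω ϱ β) (casG 0 p q a b ω ϱ β) n m α := by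
  -- Based at `α - 1`, the backward-shifted `f` is `tau L 1` and `f` itself is `tau L (X + C a)`, so
  -- only forward shifts occur.
  set L := moments p q a b ω ϱ β n m (α - 1) with hL
  have e := moments_eq_shiftBy_sub_one (p := p) (q := q) b ϱ β ha n m α
  have h1 := three_term L hN p a
  have h2 := three_term L hN q a
  have h3 := three_term_shift L hN (X + C a) p q
  have h4 := reducedRelation_eq_zero L hN (moments_cubic b ϱ β hω n m (α - 1)) p q a
  rw [reducedRelation] at h4
  rw [mul_comm (X + C p) (X + C a)] at h1
  rw [mul_comm (X + C q) (X + C a)] at h2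
  simp only [SolvesBilinearAt, bil1, bil2, bil3, bil4, casF_eq_tau, casG_eq_sigma,
    moments_add_one_left b ϱ β hp, moments_add_one_mid b ϱ β hq, e, ← hL, tau_shiftBy,
    sigma_shiftBy, mul_one, mul_assoc, subA_eq hpa, subA_eq hqa]
  simp only [mul_comm (X + C q) (X + C p)]
  refine ⟨?_, ?_, ?_, ?_⟩
  · linear_combination h1
  · linear_combination h2
  · linear_combination h3
  · linear_combination h4

end Entries

end BilinearA2

/-! ### The dependent variable transformation and its `δ`-version. -/

namespace BilinearA2

section Transformation

variable {α₂ p q a c₁ c₂ : ℂ} {f g : ℤ → ℤ → ℤ → ℂ} {n m α : ℤ}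

theorem xSeed_add_one_left (hpa : p ≠ a) :
    xSeed p q a c₁ n m = (p - a) * xSeed p q a c₁ (n + 1) m := by
  have h := sub_ne_zero.2 hpa
  rw [xSeed, xSeed, neg_add, zpow_add₀ h, zpow_neg_one]
  field_simp

theorem xSeed_add_one_right (hqa : q ≠ a) :
    xSeed p q a c₁ n m = (q - a) * xSeed p q a c₁ n (m + 1) := by
  have h := sub_ne_zero.2 hqa
  rw [xSeed, xSeed, neg_add, zpow_add₀ h, zpow_neg_one]
  field_simp

theorem A2eq1_transform (hpa : p ≠ a) (h0 : f n m α ≠ 0) (h1 : f (n + 1) m α ≠ 0) :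
    A2eq1 (xOf p q a c₁ f α) (yOf α₂ p q a c₁ c₂ f g α) (zOf α₂ p q c₂ f g α) n m =
      xSeed p q a c₁ (n + 1) m * bil1 p a f g n m α / (f n m α * f (n + 1) m α) := by
  simp only [A2eq1, xOf, yOf, zOf, ySeed, bil1, zSeed]
  rw [xSeed_add_one_left (n := n) hpa]
  field_simp
  push_cast
  ring

theorem A2eq2_transform (hqa : q ≠ a) (h0 : f n m α ≠ 0) (h1 : f n (m + 1) α ≠ 0) :
    A2eq2 (xOf p q a c₁ f α) (yOf α₂ p q a c₁ c₂ f g α) (zOf α₂ p q c₂ f g α) n m =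
      xSeed p q a c₁ n (m + 1) * bil2 q a f g n m α / (f n m α * f n (m + 1) α) := by
  simp only [A2eq2, xOf, yOf, zOf, ySeed, bil2, zSeed]
  rw [xSeed_add_one_right (m := m) hqa]
  field_simp
  push_cast
  ring

theorem zOf_sub_zOf (h1 : f (n + 1) m α ≠ 0) (h2 : f n (m + 1) α ≠ 0) :
    (zOf α₂ p q c₂ f g α (n + 1) m - zOf α₂ p q c₂ f g α n (m + 1))
        * (f (n + 1) m α * f n (m + 1) α)
      = -(bil3 p q f g n m α + (p - q) * f n m α * f (n + 1) (m + 1) α) := by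
  simp only [zOf, zSeed, bil3]
  field_simp
  push_cast
  ring

theorem A2eq3_transform (hpa : p ≠ a) (hqa : q ≠ a) (hpq : p ≠ q) (hf : NonzeroOnSquare f n m α)
    (hz : zOf α₂ p q c₂ f g α (n + 1) m ≠ zOf α₂ p q c₂ f g α n (m + 1)) :
    A2eq3 (latticeP α₂ a p) (latticeP α₂ a q)
        (xOf p q a c₁ f α) (yOf α₂ p q a c₁ c₂ f g α) (zOf α₂ p q c₂ f g α) n m =
      xSeed p q a c₁ n m *
        (bil3 p q f g n m α * bil4 α₂ p q a f g n m α
          + (p - q) * f n m α * f (n + 1) (m + 1) α * bil4 α₂ p q a f g n m α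
          + (subA α₂ a p * f n (m + 1) α * f (n + 1) m (α - 1)
              - subA α₂ a q * f (n + 1) m α * f n (m + 1) (α - 1))
            * bil3 p q f g n m α) /
        ((p - q) * f n m α * f (n + 1) m α * f n (m + 1) α * f (n + 1) (m + 1) α *
          (zOf α₂ p q c₂ f g α (n + 1) m - zOf α₂ p q c₂ f g α n (m + 1))) := by
  obtain ⟨h0, h1, h2, h3⟩ := hf
  have hd := zOf_sub_zOf (α₂ := α₂) (p := p) (q := q) (c₂ := c₂) (f := f) (g := g) h1 h2
  have hz' := sub_ne_zero.2 hz
  have hpq' := sub_ne_zero.2 hpq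
  set d := zOf α₂ p q c₂ f g α (n + 1) m - zOf α₂ p q c₂ f g α n (m + 1) with hdd
  have hP : latticeP α₂ a p = subA α₂ a p * (p - a) :=
    (div_mul_cancel₀ _ (sub_ne_zero.2 hpa)).symm
  have hQ : latticeP α₂ a q = subA α₂ a q * (q - a) :=
    (div_mul_cancel₀ _ (sub_ne_zero.2 hqa)).symm
  have hx1 : latticeP α₂ a p * xOf p q a c₁ f α (n + 1) m
      = subA α₂ a p * xSeed p q a c₁ n m * (f (n + 1) m (α - 1) / f (n + 1) m α) := by
    rw [hP, xSeed_add_one_left hpa, xOf]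
    ring
  have hx2 : latticeP α₂ a q * xOf p q a c₁ f α n (m + 1)
      = subA α₂ a q * xSeed p q a c₁ n m * (f n (m + 1) (α - 1) / f n (m + 1) α) := by
    rw [hQ, xSeed_add_one_right hqa, xOf]
    ring
  -- The background contributes `3 c₃ - p - q - a`; the choice `c₃ = α₂ / 3` makes this minus the
  -- coefficient `p + q + a - α₂` in `bil4`.
  have hlin : xOf p q a c₁ f α n m * zOf α₂ p q c₂ f g α (n + 1) (m + 1)
        - yOf α₂ p q a c₁ c₂ f g α n m
      = -xSeed p q a c₁ n m * (bil4 α₂ p q a f g n m α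
          + subA α₂ a p * f n (m + 1) α * f (n + 1) m (α - 1)
          - subA α₂ a q * f (n + 1) m α * f n (m + 1) (α - 1))
        / ((p - q) * f n m α * f (n + 1) (m + 1) α) := by
    simp only [xOf, yOf, zOf, ySeed, zSeed, bil4]
    field_simp
    push_cast
    ring
  rw [A2eq3, ← hdd, hx1, hx2, hlin]
  -- Replacing `bil3` by its expression in `d` leaves a rational identity with `d` as an independent
  -- nonzero variable.
  have hb : bil3 p q f g n m α
      = -(d * (f (n + 1) m α * f n (m + 1) α)) - (p - q) * f n m α * f (n + 1) (m + 1) α := by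
    linear_combination hd
  rw [hb]
  field_simp
  ring

theorem solvesA2At_of_solvesBilinearAt (hpa : p ≠ a) (hqa : q ≠ a) (hpq : p ≠ q)
    (hf : NonzeroOnSquare f n m α) (h : SolvesBilinearAt α₂ p q a f g n m α) :
    SolvesA2At (latticeP α₂ a p) (latticeP α₂ a q)
      (xOf p q a c₁ f α) (yOf α₂ p q a c₁ c₂ f g α) (zOf α₂ p q c₂ f g α) n m := by
  obtain ⟨b1, b2, b3, b4⟩ := h
  have hf' := hf
  obtain ⟨h0, h1, h2, h3⟩ := hf'
  have hz : zOf α₂ p q c₂ f g α (n + 1) m ≠ zOf α₂ p q c₂ f g α n (m + 1) := by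
    intro hz
    have hd := zOf_sub_zOf (α₂ := α₂) (p := p) (q := q) (c₂ := c₂) (f := f) (g := g) h1 h2
    -- Once `bil3` vanishes, equality of the two values of `z` would force `(p - q) f` times its
    -- doubly shifted value to be zero.
    rw [hz, b3, sub_self, zero_mul, zero_add, eq_comm, neg_eq_zero] at hd
    exact mul_ne_zero (mul_ne_zero (sub_ne_zero.2 hpq) h0) h3 hd
  refine ⟨hz, ?_, ?_, ?_⟩
  · rw [A2eq1_transform hpa h0 h1, b1, mul_zero, zero_div]
  · rw [A2eq2_transform hqa h0 h2, b2, mul_zero, zero_div]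
  · rw [A2eq3_transform hpa hqa hpq hf hz, b3, b4]
    simp

theorem xSeed_ne_zero (hpa : p ≠ a) (hqa : q ≠ a) (hc : c₁ ≠ 0) : xSeed p q a c₁ n m ≠ 0 :=
  mul_ne_zero (mul_ne_zero (zpow_ne_zero _ (sub_ne_zero.2 hpa))
    (zpow_ne_zero _ (sub_ne_zero.2 hqa))) hc

theorem solvesBilinearAt_of_solvesA2At (hpa : p ≠ a) (hqa : q ≠ a) (hpq : p ≠ q)
    (hf : NonzeroOnSquare f n m α) (hc : c₁ ≠ 0) (b3 : bil3 p q f g n m α = 0)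
    (h : SolvesA2At (latticeP α₂ a p) (latticeP α₂ a q)
      (xOf p q a c₁ f α) (yOf α₂ p q a c₁ c₂ f g α) (zOf α₂ p q c₂ f g α) n m) :
    SolvesBilinearAt α₂ p q a f g n m α := by
  obtain ⟨hz, e1, e2, e3⟩ := h
  have hf' := hf
  obtain ⟨h0, h1, h2, h3⟩ := hf'
  have hx : ∀ i j, xSeed p q a c₁ i j ≠ 0 := fun _ _ => xSeed_ne_zero hpa hqa hc
  have hz' := sub_ne_zero.2 hz
  have hpq' := sub_ne_zero.2 hpq
  rw [A2eq1_transform hpa h0 h1] at e1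
  rw [A2eq2_transform hqa h0 h2] at e2
  rw [A2eq3_transform hpa hqa hpq hf hz, b3] at e3
  refine ⟨?_, ?_, b3, ?_⟩
  · simpa [h0, h1, hx] using e1
  · simpa [h0, h2, hx] using e2
  · simpa [h0, h1, h2, h3, hx, hz', hpq'] using e3

theorem solvesBilinearAt_add_mul (c : ℂ) :
    SolvesBilinearAt α₂ p q a f (fun i j h => g i j h + c * f i j h) n m α ↔
      SolvesBilinearAt α₂ p q a f g n m α := by
  have e1 : bil1 p a f (fun i j h => g i j h + c * f i j h) n m α = bil1 p a f g n m α := by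
    simp only [bil1]; ring
  have e2 : bil2 q a f (fun i j h => g i j h + c * f i j h) n m α = bil2 q a f g n m α := by
    simp only [bil2]; ring
  have e3 : bil3 p q f (fun i j h => g i j h + c * f i j h) n m α = bil3 p q f g n m α := by
    simp only [bil3]; ring
  have e4 : bil4 α₂ p q a f (fun i j h => g i j h + c * f i j h) n m α
      = bil4 α₂ p q a f g n m α := by
    simp only [bil4]; ring
  rw [SolvesBilinearAt, SolvesBilinearAt, e1, e2, e3, e4]

theorem solvesA2deltaAt_add (δ P Q : ℂ) (x y z : ℤ → ℤ → ℂ) (n m : ℤ) :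
    SolvesA2deltaAt δ P Q x y (fun i j => z i j + δ) n m ↔ SolvesA2At P Q x y z n m := by
  have e1 : A2deltaEq1 δ x y (fun i j => z i j + δ) n m = A2eq1 x y z n m := by
    simp only [A2deltaEq1, A2eq1]; ring
  have e2 : A2deltaEq2 δ x y (fun i j => z i j + δ) n m = A2eq2 x y z n m := by
    simp only [A2deltaEq2, A2eq2]; ring
  have e3 : A2deltaEq3 δ P Q x y (fun i j => z i j + δ) n m = A2eq3 P Q x y z n m := by
    simp only [A2deltaEq3, A2eq3, add_sub_add_right_eq_sub]; ring
  rw [SolvesA2deltaAt, SolvesA2At, e1, e2, e3, ne_eq, add_left_inj]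

/-- Adding `c f` to `g` is absorbed by lowering the additive constant of the background `z₀` by `c`.
-/
theorem yOf_eq_of_add_mul {c c₂' : ℂ} (hc : c₂' + c = c₂) :
    yOf α₂ p q a c₁ c₂ f g α n m
      = yOf α₂ p q a c₁ c₂' f (fun i j h => g i j h + c * f i j h) α n m := by
  subst hc
  simp only [yOf, ySeed, zSeed]
  ring

theorem zDeltaOf_eq_zOf_add {δ c c₂' : ℂ} (hf : f n m α ≠ 0) (hc : c₂' + c = c₂) :
    zDeltaOf δ α₂ p q c₂' f (fun i j h => g i j h + c * f i j h) α n m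
      = zOf α₂ p q c₂ f g α n m + δ := by
  subst hc
  simp only [zDeltaOf, zOf, zSeed]
  field_simp
  ring

end Transformation

end BilinearA2

theorem mainTheorem5 (α₂ p q a c₁ c₂ : ℂ) (hpa : p ≠ a) (hqa : q ≠ a) :
    -- relations between the A2 equations and the bilinear equations
    (∀ (f g : ℤ → ℤ → ℤ → ℂ) (n m α : ℤ),
      (f n m α ≠ 0 → f (n + 1) m α ≠ 0 →
        A2eq1 (xOf p q a c₁ f α) (yOf α₂ p q a c₁ c₂ f g α)
            (zOf α₂ p q c₂ f g α) n m =
          xSeed p q a c₁ (n + 1) m * bil1 p a f g n m α /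
            (f n m α * f (n + 1) m α)) ∧
      (f n m α ≠ 0 → f n (m + 1) α ≠ 0 →
        A2eq2 (xOf p q a c₁ f α) (yOf α₂ p q a c₁ c₂ f g α)
            (zOf α₂ p q c₂ f g α) n m =
          xSeed p q a c₁ n (m + 1) * bil2 q a f g n m α /
            (f n m α * f n (m + 1) α)) ∧
      (p ≠ q → NonzeroOnSquare f n m α →
        zOf α₂ p q c₂ f g α (n + 1) m ≠ zOf α₂ p q c₂ f g α n (m + 1) →
        A2eq3 (latticeP α₂ a p) (latticeP α₂ a q)
            (xOf p q a c₁ f α) (yOf α₂ p q a c₁ c₂ f g α)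
            (zOf α₂ p q c₂ f g α) n m =
          xSeed p q a c₁ n m *
            (bil3 p q f g n m α * bil4 α₂ p q a f g n m α
              + (p - q) * f n m α * f (n + 1) (m + 1) α * bil4 α₂ p q a f g n m α
              + (subA α₂ a p * f n (m + 1) α * f (n + 1) m (α - 1)
                  - subA α₂ a q * f (n + 1) m α * f n (m + 1) (α - 1))
                * bil3 p q f g n m α) /
            ((p - q) * f n m α * f (n + 1) m α * f n (m + 1) α * f (n + 1) (m + 1) α *
              (zOf α₂ p q c₂ f g α (n + 1) m
                - zOf α₂ p q c₂ f g α n (m + 1))))) ∧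
    -- bilinearization
    (∀ (f g : ℤ → ℤ → ℤ → ℂ) (n m α : ℤ), p ≠ q → NonzeroOnSquare f n m α →
      (SolvesBilinearAt α₂ p q a f g n m α →
        SolvesA2At (latticeP α₂ a p) (latticeP α₂ a q)
          (xOf p q a c₁ f α) (yOf α₂ p q a c₁ c₂ f g α)
          (zOf α₂ p q c₂ f g α) n m) ∧
      (c₁ ≠ 0 → bil3 p q f g n m α = 0 →
        (SolvesA2At (latticeP α₂ a p) (latticeP α₂ a q)
          (xOf p q a c₁ f α) (yOf α₂ p q a c₁ c₂ f g α)
          (zOf α₂ p q c₂ f g α) n m ↔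
        SolvesBilinearAt α₂ p q a f g n m α))) ∧
    -- invariance of the bilinear equations under `g ↦ g + c f`
    (∀ (f g : ℤ → ℤ → ℤ → ℂ) (c : ℂ) (n m α : ℤ),
      SolvesBilinearAt α₂ p q a f (fun i j h => g i j h + c * f i j h) n m α ↔
        SolvesBilinearAt α₂ p q a f g n m α) ∧
    -- the `δ`-deformed equations in terms of the A2 equations
    (∀ (δ : ℂ) (x y z : ℤ → ℤ → ℂ) (n m : ℤ),
      SolvesA2deltaAt δ (latticeP α₂ a p) (latticeP α₂ a q)
          x y (fun i j => z i j + δ) n m ↔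
        SolvesA2At (latticeP α₂ a p) (latticeP α₂ a q)
          x y z n m) ∧
    -- Casoratian solutions
    (∀ (N : ℕ) (k : Fin N → ℂ) (ω ϱ : Fin N → Fin 3 → ℂ) (b : ℂ) (β : ℤ),
      1 ≤ N → IsDispersion α₂ k ω →
      (∀ j s, p ≠ ω j s ∧ q ≠ ω j s ∧ a ≠ ω j s) →
      -- multisoliton solutions of the bilinear equations
      (∀ n m α : ℤ, SolvesBilinearAt α₂ p q a
        (casF 0 p q a b ω ϱ β) (casG 0 p q a b ω ϱ β) n m α) ∧
      -- multisoliton solutions of A2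
      (∀ n m α : ℤ, p ≠ q →
        NonzeroOnSquare (casF 0 p q a b ω ϱ β) n m α →
        SolvesA2At (latticeP α₂ a p) (latticeP α₂ a q)
          (xOf p q a c₁ (casF 0 p q a b ω ϱ β) α)
          (yOf α₂ p q a c₁ c₂ (casF 0 p q a b ω ϱ β)
            (casG 0 p q a b ω ϱ β) α)
          (zOf α₂ p q c₂ (casF 0 p q a b ω ϱ β)
            (casG 0 p q a b ω ϱ β) α) n m) ∧
      -- the `δ`-extension
      (∀ δ : ℂ,
        (∀ n m α : ℤ,
          casF δ p q a b ω ϱ β n m α = casF 0 p q a b ω ϱ β n m α ∧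
          casG δ p q a b ω ϱ β n m α =
            casG 0 p q a b ω ϱ β n m α
              + N * δ * casF 0 p q a b ω ϱ β n m α ∧
          SolvesBilinearAt α₂ p q a
            (casF δ p q a b ω ϱ β) (casG δ p q a b ω ϱ β) n m α) ∧
        ∀ c₂' : ℂ, c₂' - c₂ + N * δ = 0 →
          (∀ n m α : ℤ, casF 0 p q a b ω ϱ β n m α ≠ 0 →
            xOf p q a c₁ (casF 0 p q a b ω ϱ β) α n m =
              xOf p q a c₁ (casF δ p q a b ω ϱ β) α n m ∧
            yOf α₂ p q a c₁ c₂ (casF 0 p q a b ω ϱ β)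
                (casG 0 p q a b ω ϱ β) α n m =
              yOf α₂ p q a c₁ c₂' (casF δ p q a b ω ϱ β)
                (casG δ p q a b ω ϱ β) α n m ∧
            zOf α₂ p q c₂ (casF 0 p q a b ω ϱ β)
                (casG 0 p q a b ω ϱ β) α n m =
              zDeltaOf δ α₂ p q c₂' (casF δ p q a b ω ϱ β)
                (casG δ p q a b ω ϱ β) α n m - δ) ∧
          (∀ n m α : ℤ, p ≠ q →
            NonzeroOnSquare (casF δ p q a b ω ϱ β) n m α →
            SolvesA2deltaAt δ (latticeP α₂ a p) (latticeP α₂ a q)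
              (xOf p q a c₁ (casF δ p q a b ω ϱ β) α)
              (yOf α₂ p q a c₁ c₂' (casF δ p q a b ω ϱ β)
                (casG δ p q a b ω ϱ β) α)
              (zDeltaOf δ α₂ p q c₂' (casF δ p q a b ω ϱ β)
                (casG δ p q a b ω ϱ β) α) n m))) := by
  refine ⟨fun f g n m α => ⟨A2eq1_transform hpa, A2eq2_transform hqa,
      A2eq3_transform hpa hqa⟩,
    fun f g n m α hpq hf => ⟨solvesA2At_of_solvesBilinearAt hpa hqa hpq hf,
      fun hc b3 => ⟨solvesBilinearAt_of_solvesA2At hpa hqa hpq hf hc b3,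
        solvesA2At_of_solvesBilinearAt hpa hqa hpq hf⟩⟩,
    fun f g c n m α => solvesBilinearAt_add_mul c,
    fun δ x y z n m => solvesA2deltaAt_add δ _ _ x y z n m, ?_⟩
  intro N k ω ϱ b β hN hω hne
  have hbil : ∀ n m α : ℤ, SolvesBilinearAt α₂ p q a
      (casF 0 p q a b ω ϱ β) (casG 0 p q a b ω ϱ β) n m α :=
    casoratian_solvesBilinearAt b ϱ β hN hω (fun j s => (hne j s).1)
      (fun j s => (hne j s).2.1) (fun j s => (hne j s).2.2) hpa hqa
  refine ⟨hbil, fun n m α hpq hf =>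
    solvesA2At_of_solvesBilinearAt hpa hqa hpq hf (hbil n m α), fun δ => ?_⟩
  rw [casF_delta p q a b ω ϱ β δ, casG_delta p q a b ω ϱ β hN δ]
  refine ⟨fun n m α => ⟨rfl, rfl, (solvesBilinearAt_add_mul (N * δ)).2 (hbil n m α)⟩,
    fun c₂' hc => ⟨fun n m α hf => ⟨rfl, ?_, ?_⟩, fun n m α hpq hf => ?_⟩⟩
  · exact yOf_eq_of_add_mul (by linear_combination hc)
  · rw [zDeltaOf_eq_zOf_add hf (c₂ := c₂) (c₂' := c₂') (c := N * δ) (by linear_combination hc),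
      add_sub_cancel_right]
  -- `z'` is `δ` plus the A2 transform of `f` and `g + N δ f` with constant `c₂'`; that pair is
  -- again bilinear by the invariance under `g ↦ g + c f`.
  · have hz : zDeltaOf δ α₂ p q c₂' (casF 0 p q a b ω ϱ β)
        (fun n m α => casG 0 p q a b ω ϱ β n m α + N * δ * casF 0 p q a b ω ϱ β n m α) α
        = fun i j => zOf α₂ p q c₂' (casF 0 p q a b ω ϱ β) (fun n m α =>
          casG 0 p q a b ω ϱ β n m α + N * δ * casF 0 p q a b ω ϱ β n m α) α i j + δ := by
      funext i j
      simp only [zDeltaOf, zOf]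
      ring
    rw [hz]
    exact (solvesA2deltaAt_add δ _ _ _ _ _ n m).2
      (solvesA2At_of_solvesBilinearAt hpa hqa hpq hf
        ((solvesBilinearAt_add_mul (N * δ)).2 (hbil n m α)))
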